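/- Let $n$ be a natural number and let $\mathbb{T}^n = \mathbb{R}^n/\mathbb{Z}^n$, with $\overline{x} = x + \mathbb{Z}^n$ for $x \in \mathbb{R}^n$. A toral automorphism of $\mathbb{T}^n$ is a map $f = f_A \colon \mathbb{T}^n \to \mathbb{T}^n$ of the form $f_A(\overline{x}) = \overline{Ax}$ with $A \in \mathrm{GL}_n(\mathbb{Z})$. Let $d$ be the metric $d(p,q) = \max_i d_{\mathbb{R}/\mathbb{Z}}(p_i,q_i)$ on $\mathbb{T}^n$ (where $d_{\mathbb{R}/\mathbb{Z}}$ is the quotient metric on $\mathbb{R}/\mathbb{Z}$; any other metric compatible with the topology gives the same notion). Two points $p,q \in \mathbb{T}^n$ are called $f$-homoclinic if $d(f^k(p), f^k(q)) \to 0$ as $|k| \to \infty$, $k \in \mathbb{Z}$; this is an equivalence relation, whose classes are called the $f$-homoclinicity classes. **Proposition.** Let $f \colon \mathbb{T}^n \to \mathbb{T}^n$ be a toral automorphism that is ergodic with respect to the Lebesgue measure on $\mathbb{T}^n$. Then the dynamical system $(\mathbb{T}^n, f)$ has the Moore property: if $\tau \colon \mathbb{T}^n \to \mathbb{T}^n$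 is a surjective continuous map with $\tau \circ f = f \circ \tau$, then the restriction of $\tau$ to each $f$-homoclinicity class is injective. -/

import Mathlib

open Filter Topology MeasureTheory

namespace TopDyn

variable {X : Type*} [MetricSpace X]

/-- Two points `x, y` are `f`-homoclinic if `d(f^k x, f^k y) → 0` as `|k| → ∞`, where `k` runs over
the integers. -/
def Homoclinic (f : X ≃ₜ X) (x y : X) : Prop :=
  Tendsto (fun k : ℤ => dist ((f ^ k) x) ((f ^ k) y)) (comap (fun k : ℤ => |k|) atTop) (𝓝 0)

theorem homoclinic_equivalence (f : X ≃ₜ X) : Equivalence (Homoclinic f) where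
  refl x := by simp [Homoclinic]
  symm {x y} h := by simpa [Homoclinic, dist_comm] using h
  trans {x y z} h₁ h₂ :=
    squeeze_zero (fun _ => dist_nonneg) (fun _ => dist_triangle _ _ _)
      (by simpa using Tendsto.add h₁ h₂)

/-- The equivalence relation of `f`-homoclinicity. -/
def homoclinicSetoid (f : X ≃ₜ X) : Setoid X := ⟨Homoclinic f, homoclinic_equivalence f⟩

/-- Endomorphisms of the dynamical system `(X, f)`: continuous self-maps commuting with `f`. -/
def IsEndomorphism (f : X ≃ₜ X) (τ : X → X) : Prop :=
  Continuous τ ∧ ∀ x, τ (f x) = f (τ x)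

/-- `τ` is pre-injective with respect to `f` if its restriction to each `f`-homoclinicity class is
injective. -/
def PreInjective (f : X ≃ₜ X) (τ : X → X) : Prop :=
  ∀ C ∈ (homoclinicSetoid f).classes, Set.InjOn τ C

/-- `(X, f)` has the Moore property if every surjective endomorphism is pre-injective. -/
def MooreProperty (f : X ≃ₜ X) : Prop :=
  ∀ τ : X → X, IsEndomorphism f τ → Function.Surjective τ → PreInjective f τ

end TopDyn

namespace Toral

variable {n : ℕ}

/-- The canonical projection `ℝⁿ → 𝕋ⁿ = ℝⁿ/ℤⁿ`. -/
def proj (x : Fin n → ℝ) : UnitAddTorus (Fin n) := fun i => (x i : UnitAddCircle)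

/-- The toral endomorphism associated with an integral matrix `A`, acting on column vectors. -/
def toralEnd (A : Matrix (Fin n) (Fin n) ℤ) (p : UnitAddTorus (Fin n)) : UnitAddTorus (Fin n) :=
  fun i => ∑ j, A i j • p j

/-- The map `toralEnd A` is the one induced by `x ↦ A x` on `ℝⁿ`. -/
theorem toralEnd_proj (A : Matrix (Fin n) (Fin n) ℤ) (x : Fin n → ℝ) :
    toralEnd A (proj x) = proj ((A.map (Int.cast : ℤ → ℝ)).mulVec x) := by
  ext i
  simp only [toralEnd, proj, Matrix.mulVec, dotProduct, Matrix.map_apply, ← zsmul_eq_mul]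
  rw [← QuotientAddGroup.mk'_apply, map_sum]
  rfl

theorem continuous_toralEnd (A : Matrix (Fin n) (Fin n) ℤ) : Continuous (toralEnd A) := by
  unfold toralEnd
  fun_prop

theorem toralEnd_one (p : UnitAddTorus (Fin n)) : toralEnd 1 p = p := by
  ext i
  simp [toralEnd, Matrix.one_apply, ite_smul]

theorem toralEnd_mul (A B : Matrix (Fin n) (Fin n) ℤ) (p : UnitAddTorus (Fin n)) :
    toralEnd (A * B) p = toralEnd A (toralEnd B p) := by
  ext i
  simp only [toralEnd, Matrix.mul_apply, Finset.sum_smul, Finset.smul_sum, mul_smul]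
  exact Finset.sum_comm

/-- The toral automorphism `f_A` associated with `A ∈ GL_n(ℤ)`, as a homeomorphism of `𝕋ⁿ`. -/
def toralAut (A : GL (Fin n) ℤ) : UnitAddTorus (Fin n) ≃ₜ UnitAddTorus (Fin n) where
  toFun := toralEnd (A : Matrix (Fin n) (Fin n) ℤ)
  invFun := toralEnd ((A⁻¹ : GL (Fin n) ℤ) : Matrix (Fin n) (Fin n) ℤ)
  left_inv p := by rw [← toralEnd_mul, Units.inv_mul, toralEnd_one]
  right_inv p := by rw [← toralEnd_mul, Units.mul_inv, toralEnd_one]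
  continuous_toFun := continuous_toralEnd _
  continuous_invFun := continuous_toralEnd _

/-- Toral automorphisms of `𝕋ⁿ`: the maps `f_A` with `A ∈ GL_n(ℤ)`. -/
def IsToralAutomorphism (f : UnitAddTorus (Fin n) ≃ₜ UnitAddTorus (Fin n)) : Prop :=
  ∃ A : GL (Fin n) ℤ, f = toralAut A

end Toral

namespace Toral

open UnitAddTorus
open Matrix hiding zpow_add zpow_add_one zpow_sub_one zpow_neg inv_zpow

variable {n : ℕ}

/-! ### Algebra of toral endomorphisms -/

/-! An endomorphism `τ` of an ergodic toral automorphism is affine. Lifting to `ℝⁿ` gives `τ p = B p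
+ φ p` with `B` integral and `φ` continuous into `ℝⁿ`. Commutation with `A` forces `φ (A p) = A φ(p)
+ m`, so the vectors `c k` of Fourier coefficients of `φ` satisfy `A⁻ʲ c(k) = c(k Aʲ)` for `k ≠ 0`.
Ergodicity makes `j ↦ k Aʲ` injective, so this two-sided orbit tends to `0`; by an eigenvalue
argument `c k = 0`, and `φ` is constant.

Surjectivity then gives `det B ≠ 0`, so points with the same image differ by a `det B`-torsion
point. Torsion points of that order form a finite `A`-invariant set, where an orbit tending to `0`
must reach `0`. Hence homoclinic points with the same image coincide. -/

theorem toralEnd_add (A : Matrix (Fin n) (Fin n) ℤ) (p q : UnitAddTorus (Fin n)) :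
    toralEnd A (p + q) = toralEnd A p + toralEnd A q := by
  ext i
  simp [toralEnd, smul_add, Finset.sum_add_distrib]

theorem toralEnd_sub (A : Matrix (Fin n) (Fin n) ℤ) (p q : UnitAddTorus (Fin n)) :
    toralEnd A (p - q) = toralEnd A p - toralEnd A q := by
  ext i
  simp [toralEnd, smul_sub, Finset.sum_sub_distrib]

theorem toralEnd_zero (A : Matrix (Fin n) (Fin n) ℤ) : toralEnd A 0 = 0 := by
  ext i
  simp [toralEnd]

theorem toralEnd_smul_one (d : ℤ) (p : UnitAddTorus (Fin n)) :
    toralEnd (d • (1 : Matrix (Fin n) (Fin n) ℤ)) p = d • p := by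
  ext i
  simp [toralEnd, Matrix.one_apply, ite_smul]

/-- The group of toral automorphisms as the image of `GL_n(ℤ)`. -/
def toralAutHom (n : ℕ) : GL (Fin n) ℤ →* (UnitAddTorus (Fin n) ≃ₜ UnitAddTorus (Fin n)) where
  toFun := toralAut
  map_one' := by
    ext1 p
    exact toralEnd_one p
  map_mul' A B := by
    ext1 p
    exact toralEnd_mul (A : Matrix (Fin n) (Fin n) ℤ) B p

theorem toralAut_zpow_apply (A : GL (Fin n) ℤ) (k : ℤ) (p : UnitAddTorus (Fin n)) :
    (toralAut A ^ k) p = toralEnd ((A ^ k : GL (Fin n) ℤ) : Matrix (Fin n) (Fin n) ℤ) p := by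
  have := map_zpow (toralAutHom n) A k
  exact (DFunLike.congr_fun this p).symm

/-! ### Characters -/

theorem mFourier_eq_toCircle (k : Fin n → ℤ) (p : UnitAddTorus (Fin n)) :
    mFourier k p = ((∑ i, k i • p i : UnitAddCircle).toCircle : ℂ) := by
  have h : ∀ s : Finset (Fin n), ((∑ i ∈ s, k i • p i : UnitAddCircle).toCircle : ℂ)
      = ∏ i ∈ s, fourier (k i) (p i) := by
    intro s
    induction s using Finset.cons_induction with
    | empty => simp
    | cons a s ha ih =>
      rw [Finset.sum_cons, Finset.prod_cons, AddCircle.toCircle_add, Circle.coe_mul, ih,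
        fourier_apply]
  exact (h Finset.univ).symm

theorem mFourier_toralEnd (A : Matrix (Fin n) (Fin n) ℤ) (k : Fin n → ℤ)
    (p : UnitAddTorus (Fin n)) : mFourier k (toralEnd A p) = mFourier (k ᵥ* A) p := by
  rw [mFourier_eq_toCircle, mFourier_eq_toCircle]
  congr 2
  simp only [toralEnd, vecMul, dotProduct, Finset.smul_sum, Finset.sum_smul, mul_smul]
  exact Finset.sum_comm

/-! ### Fourier coefficients -/

/-- The normalized Haar measure on the torus. -/
noncomputable abbrev haarTorus (n : ℕ) : Measure (UnitAddTorus (Fin n)) :=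
  Measure.pi fun _ => AddCircle.haarAddCircle

theorem volume_eq_haarTorus : (volume : Measure (UnitAddTorus (Fin n))) = haarTorus n := by
  have : (volume : Measure UnitAddCircle) = AddCircle.haarAddCircle := by
    rw [AddCircle.volume_eq_smul_haarAddCircle]
    simp
  rw [volume_pi, this]

theorem mFourierCoeff_def (g : UnitAddTorus (Fin n) → ℂ) (k : Fin n → ℤ) :
    mFourierCoeff g k = ∫ p, mFourier (-k) p * g p ∂haarTorus n := rfl

theorem integrable_haarTorus {g : UnitAddTorus (Fin n) → ℂ} (hg : Continuous g) :
    Integrable g (haarTorus n) :=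
  hg.integrable_of_hasCompactSupport (HasCompactSupport.of_compactSpace g)

theorem integral_mFourier {k : Fin n → ℤ} (hk : k ≠ 0) :
    ∫ p, mFourier k p ∂haarTorus n = 0 := by
  obtain ⟨i, hi⟩ := Function.ne_iff.mp hk
  have hi' : k i ≠ 0 := hi
  rw [mFourier, ContinuousMap.coe_mk]
  rw [integral_fintype_prod_eq_prod (𝕜 := ℂ) (fun i (x : UnitAddCircle) => (fourier (k i) x : ℂ))]
  apply Finset.prod_eq_zero (Finset.mem_univ i)
  have := (orthonormal_iff_ite.mp (orthonormal_fourier (T := 1))) 0 (k i)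
  simpa [ContinuousMap.inner_toLp, hi'.symm] using this

theorem tendsto_mFourierCoeff (g : C(UnitAddTorus (Fin n), ℂ)) :
    Tendsto (mFourierCoeff g) cofinite (𝓝 0) := by
  have h := (hasSum_sq_mFourierCoeff (ContinuousMap.toLp 2 (haarTorus n) ℂ g)).summable.tendsto_cofinite_zero
  have h1 : ∀ k, mFourierCoeff (ContinuousMap.toLp 2 (haarTorus n) ℂ g) k = mFourierCoeff g k :=
    mFourierCoeff_toLp g
  simp only [h1] at h
  rw [tendsto_zero_iff_norm_tendsto_zero]
  simpa using h.sqrt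

theorem eq_mFourierCoeff_zero {g : C(UnitAddTorus (Fin n), ℂ)}
    (hg : ∀ k, k ≠ 0 → mFourierCoeff g k = 0) (p : UnitAddTorus (Fin n)) :
    g p = mFourierCoeff g 0 := by
  have hs : Summable (mFourierCoeff g) := summable_of_ne_finset_zero (s := {0}) (by simpa using hg)
  have h1 := hasSum_mFourier_series_apply_of_summable hs p
  have h2 := hasSum_single (f := fun k => mFourierCoeff g k • mFourier k p) 0
    (fun k hk => by simp [hg k hk])
  simpa [mFourier_zero] using h1.unique h2

/-! ### Ergodicity -/

/-- On a periodic orbit of `k`, the sum of the characters is continuous and invariant, hence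
constant. Its integral is `0`, but its value at the origin is the number `j` of summands. -/
theorem vecMul_pow_ne_of_ergodic {A : GL (Fin n) ℤ} (h : Ergodic (toralAut A) (haarTorus n))
    {k : Fin n → ℤ} (hk : k ≠ 0) {j : ℕ} (hj : 0 < j) :
    k ᵥ* ((A : Matrix (Fin n) (Fin n) ℤ) ^ j) ≠ k := by
  intro hkj
  set M := (A : Matrix (Fin n) (Fin n) ℤ)
  let g : UnitAddTorus (Fin n) → ℂ := fun p => ∑ i ∈ Finset.range j, mFourier (k ᵥ* M ^ i) p
  have hgc : Continuous g := by fun_prop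
  have hginv : g ∘ toralAut A = g := by
    ext p
    have h1 : ∀ i, mFourier (k ᵥ* M ^ i) (toralAut A p) = mFourier (k ᵥ* M ^ (i + 1)) p := by
      intro i
      rw [pow_succ, ← vecMul_vecMul]
      exact mFourier_toralEnd M _ p
    simp only [g, Function.comp, h1]
    have h2 := Finset.sum_range_succ (fun i => mFourier (k ᵥ* M ^ i) p) j
    rw [Finset.sum_range_succ', hkj] at h2
    simpa using h2
  obtain ⟨c, hc⟩ := h.ae_eq_const_of_ae_eq_comp_ae hgc.aestronglyMeasurable
    (Filter.EventuallyEq.of_eq hginv)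
  have hgc' : g = fun _ => c := hgc.ae_eq_iff_eq _ continuous_const |>.mp hc
  have hne : ∀ i : ℕ, k ᵥ* M ^ i ≠ 0 := by
    intro i hi
    apply hk
    have : (k ᵥ* M ^ i) ᵥ* (((A ^ i)⁻¹ : GL (Fin n) ℤ) : Matrix (Fin n) (Fin n) ℤ) = k := by
      rw [vecMul_vecMul, ← Units.val_pow_eq_pow_val, Units.mul_inv, vecMul_one]
    rw [← this, hi, zero_vecMul]
  have hint : ∫ p, g p ∂haarTorus n = 0 := by
    simp only [g]
    rw [integral_finsetSum _ fun i _ => integrable_haarTorus (mFourier _).continuous]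
    exact Finset.sum_eq_zero fun i _ => integral_mFourier (hne i)
  have hc0 : c = 0 := by simpa [hgc'] using hint
  have hg0 : g 0 = j := by simp [g, mFourier_eq_toCircle]
  simp only [hgc', hc0] at hg0
  exact hj.ne (by exact_mod_cast hg0)

theorem vecMul_zpow_injective_of_ergodic {A : GL (Fin n) ℤ}
    (h : Ergodic (toralAut A) (haarTorus n)) {k : Fin n → ℤ} (hk : k ≠ 0) :
    Function.Injective fun j : ℤ =>
      k ᵥ* ((A ^ j : GL (Fin n) ℤ) : Matrix (Fin n) (Fin n) ℤ) := by
  have key : ∀ a b : ℤ, a < b → k ᵥ* ((A ^ a : GL (Fin n) ℤ) : Matrix (Fin n) (Fin n) ℤ) ≠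
      k ᵥ* ((A ^ b : GL (Fin n) ℤ) : Matrix (Fin n) (Fin n) ℤ) := by
    intro a b hab heq
    obtain ⟨j, hj⟩ := Int.eq_ofNat_of_zero_le (sub_nonneg.mpr hab.le)
    refine vecMul_pow_ne_of_ergodic h hk (j := j) (by omega) ?_
    have := congrArg (· ᵥ* ((A ^ (-a) : GL (Fin n) ℤ) : Matrix (Fin n) (Fin n) ℤ)) heq
    simp only [vecMul_vecMul, ← Units.val_mul, ← zpow_add, add_neg_cancel, zpow_zero,
      Units.val_one, vecMul_one] at this
    rw [← sub_eq_add_neg, hj, zpow_natCast, Units.val_pow_eq_pow_val] at this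
    exact this.symm
  intro a b hab
  rcases lt_trichotomy a b with hlt | heq | hlt
  · exact (key a b hlt hab).elim
  · exact heq
  · exact (key b a hlt hab.symm).elim

/-! ### Vectors with vanishing two-sided orbit -/

/-- Such vectors form a `G`-invariant subspace. If it is nonzero it contains an eigenvector; its
eigenvalue `c` would satisfy both `cʲ → 0` and `c⁻ʲ → 0`, although their product is `1`. -/
theorem eq_zero_of_tendsto_zpow_mulVec (G : GL (Fin n) ℂ) {v : Fin n → ℂ}
    (hv : Tendsto (fun j : ℤ => ((G ^ j : GL (Fin n) ℂ) : Matrix (Fin n) (Fin n) ℂ) *ᵥ v)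
      cofinite (𝓝 0)) : v = 0 := by
  let W : Submodule ℂ (Fin n → ℂ) :=
    { carrier := {w | Tendsto
        (fun j : ℤ => ((G ^ j : GL (Fin n) ℂ) : Matrix (Fin n) (Fin n) ℂ) *ᵥ w) cofinite (𝓝 0)}
      add_mem' := fun {a b} ha hb => by
        simpa [mulVec_add] using Tendsto.add ha hb
      zero_mem' := by simp
      smul_mem' := fun c a ha => by
        simpa [mulVec_smul] using Tendsto.const_smul ha c }
  let T : Module.End ℂ (Fin n → ℂ) := (G : Matrix (Fin n) (Fin n) ℂ).mulVecLin
  have hT : ∀ w ∈ W, T w ∈ W := by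
    intro w hw
    have := Tendsto.comp hw (add_left_injective (1 : ℤ)).tendsto_cofinite
    refine this.congr fun j => ?_
    simp only [Function.comp, T, mulVecLin_apply, mulVec_mulVec, ← Units.val_mul, zpow_add_one]
  by_contra hv0
  have : Nontrivial W := ⟨⟨⟨v, hv⟩, 0, fun h => hv0 (congrArg Subtype.val h)⟩⟩
  obtain ⟨c, hc⟩ := Module.End.exists_eigenvalue (T.restrict hT)
  obtain ⟨⟨w, hw⟩, hwe⟩ := hc.exists_hasEigenvector
  have hw0 : w ≠ 0 := fun h => hwe.2 (Subtype.ext h)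
  have hGw : (G : Matrix (Fin n) (Fin n) ℂ) *ᵥ w = c • w := congrArg Subtype.val hwe.apply_eq_smul
  have hc0 : c ≠ 0 := by
    rintro rfl
    apply hw0
    rw [← one_mulVec w, ← Units.inv_mul G, ← mulVec_mulVec, hGw]
    simp
  have hGinv : ((G⁻¹ : GL (Fin n) ℂ) : Matrix (Fin n) (Fin n) ℂ) *ᵥ w = c⁻¹ • w := by
    rw [eq_inv_smul_iff₀ hc0, ← mulVec_smul, ← hGw, mulVec_mulVec, Units.inv_mul, one_mulVec]
  have hpow : ∀ j : ℤ, ((G ^ j : GL (Fin n) ℂ) : Matrix (Fin n) (Fin n) ℂ) *ᵥ w = c ^ j • w := by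
    intro j
    induction j using Int.induction_on with
    | zero => simp
    | succ i ih =>
      rw [zpow_add_one, Units.val_mul, ← mulVec_mulVec, hGw, mulVec_smul, ih, smul_smul,
        zpow_add_one₀ hc0, mul_comm]
    | pred i ih =>
      rw [zpow_sub_one, Units.val_mul, ← mulVec_mulVec, hGinv, mulVec_smul, ih, smul_smul,
        zpow_sub_one₀ hc0, mul_comm]
  have hlim : Tendsto (fun j : ℤ => c ^ j) cofinite (𝓝 0) := by
    have hw' : Tendsto (fun j : ℤ => c ^ j • w) cofinite (𝓝 0) := by
      simpa only [hpow] using (show Tendsto _ _ _ from hw)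
    have := hw'.norm
    simp only [norm_smul, norm_zero] at this
    have h2 := this.div_const ‖w‖
    simp only [mul_div_cancel_right₀ _ (norm_ne_zero_iff.mpr hw0), zero_div] at h2
    exact tendsto_zero_iff_norm_tendsto_zero.mpr h2
  have h1 := hlim.mul (hlim.comp (neg_injective (G := ℤ)).tendsto_cofinite)
  have h2 : Tendsto (fun _ : ℤ => (1 : ℂ)) cofinite (𝓝 (0 * 0)) := by
    refine h1.congr fun j => ?_
    simp [zpow_neg, mul_inv_cancel₀ (zpow_ne_zero j hc0)]
  simpa using tendsto_nhds_unique h2 tendsto_const_nhds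

/-! ### Equivariant maps into a vector space are constant -/

theorem mFourierCoeff_comp_toralAut {A : GL (Fin n) ℤ}
    (h : MeasurePreserving (toralAut A) (haarTorus n) (haarTorus n))
    (g : UnitAddTorus (Fin n) → ℂ) (k : Fin n → ℤ) :
    mFourierCoeff (g ∘ toralAut A) (k ᵥ* (A : Matrix (Fin n) (Fin n) ℤ)) = mFourierCoeff g k := by
  rw [mFourierCoeff_def, mFourierCoeff_def,
    ← h.integral_comp (toralAut A).measurableEmbedding fun p => mFourier (-k) p * g p]
  congr with p
  rw [← neg_vecMul, ← mFourier_toralEnd]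
  rfl

/-- The constant `m` drops out because it contributes only to the zeroth coefficient. -/
theorem mFourierCoeff_eq_mulVec {A : GL (Fin n) ℤ}
    (h : MeasurePreserving (toralAut A) (haarTorus n) (haarTorus n))
    {φ : Fin n → C(UnitAddTorus (Fin n), ℂ)} {m : Fin n → ℂ}
    (hφ : ∀ i p, φ i (toralAut A p) =
      ∑ j, ((A : Matrix (Fin n) (Fin n) ℤ) i j : ℂ) * φ j p + m i)
    {k : Fin n → ℤ} (hk : k ᵥ* (A : Matrix (Fin n) (Fin n) ℤ) ≠ 0) :
    (fun i => mFourierCoeff (φ i) k) =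
      (A : Matrix (Fin n) (Fin n) ℤ).map (Int.cast : ℤ → ℂ) *ᵥ
        fun i => mFourierCoeff (φ i) (k ᵥ* (A : Matrix (Fin n) (Fin n) ℤ)) := by
  ext i
  rw [← mFourierCoeff_comp_toralAut h]
  set l := k ᵥ* (A : Matrix (Fin n) (Fin n) ℤ)
  simp only [mulVec, dotProduct, map_apply, mFourierCoeff_def, Function.comp, hφ, mul_add,
    Finset.mul_sum]
  rw [integral_add, integral_finsetSum, integral_mul_const, integral_mFourier (neg_ne_zero.mpr hk),
    zero_mul, add_zero]
  · refine Finset.sum_congr rfl fun j _ => ?_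
    rw [← integral_const_mul]
    congr with p
    ring
  · exact fun j _ => integrable_haarTorus (by fun_prop)
  · exact integrable_haarTorus (by fun_prop)
  · exact integrable_haarTorus (by fun_prop)

theorem vecMul_ne_zero (A : GL (Fin n) ℤ) {k : Fin n → ℤ} (hk : k ≠ 0) :
    k ᵥ* (A : Matrix (Fin n) (Fin n) ℤ) ≠ 0 := by
  intro h0
  apply hk
  rw [← vecMul_one k, ← Units.mul_inv A, ← vecMul_vecMul, h0, zero_vecMul]

theorem exists_eq_const_of_comp_eq {A : GL (Fin n) ℤ}
    (h : Ergodic (toralAut A) (haarTorus n))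
    {φ : Fin n → C(UnitAddTorus (Fin n), ℂ)} {m : Fin n → ℂ}
    (hφ : ∀ i p, φ i (toralAut A p) =
      ∑ j, ((A : Matrix (Fin n) (Fin n) ℤ) i j : ℂ) * φ j p + m i) :
    ∃ c : Fin n → ℂ, ∀ i p, φ i p = c i := by
  refine ⟨fun i => mFourierCoeff (φ i) 0, fun i => eq_mFourierCoeff_zero fun k hk => ?_⟩
  let F : GL (Fin n) ℤ →* GL (Fin n) ℂ := GeneralLinearGroup.map (Int.castRingHom ℂ)
  let c : (Fin n → ℤ) → Fin n → ℂ := fun k i => mFourierCoeff (φ i) k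
  have hstep : ∀ l : Fin n → ℤ, l ≠ 0 →
      c l = (F A : Matrix (Fin n) (Fin n) ℂ) *ᵥ c (l ᵥ* (A : Matrix (Fin n) (Fin n) ℤ)) :=
    fun l hl => mFourierCoeff_eq_mulVec h.toMeasurePreserving hφ (vecMul_ne_zero A hl)
  let κ : ℤ → Fin n → ℤ := fun j => k ᵥ* ((A ^ j : GL (Fin n) ℤ) : Matrix (Fin n) (Fin n) ℤ)
  have hκ : ∀ j, c (κ j) = (F A : Matrix (Fin n) (Fin n) ℂ) *ᵥ c (κ (j + 1)) := by
    intro j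
    rw [hstep (κ j) (vecMul_ne_zero _ hk)]
    simp only [κ, vecMul_vecMul, ← Units.val_mul, zpow_add_one]
  have horb : ∀ j : ℤ, (((F A) ^ j : GL (Fin n) ℂ) : Matrix (Fin n) (Fin n) ℂ) *ᵥ c (κ j) = c k := by
    have hsucc : ∀ j : ℤ, (((F A) ^ (j + 1) : GL (Fin n) ℂ) : Matrix (Fin n) (Fin n) ℂ) *ᵥ
        c (κ (j + 1)) = (((F A) ^ j : GL (Fin n) ℂ) : Matrix (Fin n) (Fin n) ℂ) *ᵥ c (κ j) := by
      intro j
      rw [hκ j, mulVec_mulVec, ← Units.val_mul, ← zpow_add_one]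
    intro j
    induction j using Int.induction_on with
    | zero => simp [κ]
    | succ i ih => rw [hsucc, ih]
    | pred i ih => rw [← hsucc, sub_add_cancel, ih]
  have hinv : ∀ j : ℤ,
      (((F A)⁻¹ ^ j : GL (Fin n) ℂ) : Matrix (Fin n) (Fin n) ℂ) *ᵥ c k = c (κ j) := by
    intro j
    rw [← horb j, mulVec_mulVec, ← Units.val_mul, inv_zpow, inv_mul_cancel, Units.val_one,
      one_mulVec]
  have hck : c k = 0 := by
    refine eq_zero_of_tendsto_zpow_mulVec (F A)⁻¹ ?_
    simp only [hinv]
    rw [tendsto_pi_nhds]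
    intro i
    exact (tendsto_mFourierCoeff (φ i)).comp
      (vecMul_zpow_injective_of_ergodic h hk).tendsto_cofinite
  exact congrFun hck i

/-! ### Lifting continuous maps of the torus -/

theorem isOpenQuotientMap_proj : IsOpenQuotientMap (proj (n := n)) :=
  IsOpenQuotientMap.piMap fun _ => QuotientAddGroup.isOpenQuotientMap_mk

theorem continuous_proj : Continuous (proj (n := n)) := isOpenQuotientMap_proj.continuous

theorem proj_surjective : Function.Surjective (proj (n := n)) := isOpenQuotientMap_proj.surjective

theorem proj_add (x y : Fin n → ℝ) : proj (x + y) = proj x + proj y := by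
  ext i
  simp [proj]

theorem proj_sub (x y : Fin n → ℝ) : proj (x - y) = proj x - proj y := by
  ext i
  simp [proj]

theorem proj_eq_zero_iff {x : Fin n → ℝ} : proj x = 0 ↔ ∃ k : Fin n → ℤ, x = fun i => (k i : ℝ) := by
  constructor
  · intro h
    have : ∀ i, ∃ k : ℤ, (k : ℝ) = x i := fun i => by
      obtain ⟨k, hk⟩ := (AddCircle.coe_eq_zero_iff (1 : ℝ)).mp (congrFun h i)
      exact ⟨k, by simpa using hk⟩
    choose k hk using this
    exact ⟨k, funext fun i => (hk i).symm⟩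
  · rintro ⟨k, rfl⟩
    ext i
    exact (AddCircle.coe_eq_zero_iff (1 : ℝ)).mpr ⟨k i, by simp⟩

theorem proj_intCast (k : Fin n → ℤ) : proj (fun i => (k i : ℝ)) = 0 :=
  proj_eq_zero_iff.mpr ⟨k, rfl⟩

/-- A continuous `ℤⁿ`-valued map on the connected space `ℝⁿ` is constant. -/
theorem eq_of_proj_eq_zero {h : (Fin n → ℝ) → Fin n → ℝ} (hc : Continuous h)
    (h0 : ∀ x, proj (h x) = 0) (x y : Fin n → ℝ) : h x = h y := by
  ext i
  have hi : Continuous fun x => h x i := by fun_prop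
  have hmem : ∀ x, h x i ∈ Set.range ((↑) : ℤ → ℝ) := fun x => by
    obtain ⟨k, hk⟩ := proj_eq_zero_iff.mp (h0 x)
    exact ⟨k i, (congrFun hk i).symm⟩
  choose k hk using hmem
  have hkc : Continuous k := by
    rw [Int.isClosedEmbedding_coe_real.isEmbedding.continuous_iff]
    exact hi.congr fun x => (hk x).symm
  rw [← hk x, ← hk y, PreconnectedSpace.constant inferInstance hkc]

theorem exists_continuous_lift {τ : UnitAddTorus (Fin n) → UnitAddTorus (Fin n)}
    (hτ : Continuous τ) :
    ∃ g : (Fin n → ℝ) → Fin n → ℝ, Continuous g ∧ ∀ x, τ (proj x) = proj (g x) := by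
  have hlift : ∀ i, ∃ G : C(Fin n → ℝ, ℝ), ∀ x, ((G x : ℝ) : UnitAddCircle) = τ (proj x) i := by
    intro i
    let T : C(Fin n → ℝ, UnitAddCircle) :=
      ⟨fun x => τ (proj x) i, (continuous_apply i).comp (hτ.comp continuous_proj)⟩
    obtain ⟨e, he⟩ := QuotientAddGroup.mk_surjective (T 0)
    obtain ⟨G, ⟨-, hG⟩, -⟩ :=
      (AddCircle.isCoveringMap_coe (1 : ℝ)).existsUnique_continuousMap_lifts T 0 e he
    exact ⟨G, fun x => congrFun hG x⟩
  choose G hG using hlift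
  exact ⟨fun x i => G i x, by fun_prop, fun x => funext fun i => (hG i x).symm⟩

/-- A lift `g` changes by a constant integer vector `b k` under translation by `k`. The map `b` is
additive, so it is a matrix `B`, and `g - B` is periodic. -/
theorem exists_matrix_add_periodic {τ : UnitAddTorus (Fin n) → UnitAddTorus (Fin n)}
    (hτ : Continuous τ) :
    ∃ (B : Matrix (Fin n) (Fin n) ℤ) (φ : UnitAddTorus (Fin n) → Fin n → ℝ), Continuous φ ∧
      ∀ p, τ p = toralEnd B p + proj (φ p) := by
  obtain ⟨g, hg, hτg⟩ := exists_continuous_lift hτ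
  have hper : ∀ k : Fin n → ℤ, ∃ l : Fin n → ℤ, ∀ x,
      g (x + fun i => (k i : ℝ)) - g x = fun i => (l i : ℝ) := by
    intro k
    have h0 : ∀ x, proj (g (x + fun i => (k i : ℝ)) - g x) = 0 := by
      intro x
      rw [proj_sub, ← hτg, ← hτg, proj_add, proj_intCast, add_zero, sub_self]
    obtain ⟨l, hl⟩ := proj_eq_zero_iff.mp (h0 0)
    refine ⟨l, fun x => ?_⟩
    rw [← hl]
    exact eq_of_proj_eq_zero (by fun_prop) h0 x 0
  choose b hb using hper
  have hadd : ∀ k l, b (k + l) = b k + b l := by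
    intro k l
    ext i
    have h1 := congrFun (hb (k + l) 0) i
    have h2 := congrFun (hb k (fun i => (l i : ℝ))) i
    have h3 := congrFun (hb l 0) i
    have h4 : (0 : Fin n → ℝ) + (fun i => ((k + l) i : ℝ)) =
        (fun i => (l i : ℝ)) + fun i => (k i : ℝ) := by
      ext i
      simp [add_comm]
    rw [h4] at h1
    simp only [Pi.sub_apply, zero_add] at h1 h2 h3
    have : ((b (k + l) i : ℤ) : ℝ) = b k i + b l i := by linarith
    exact_mod_cast this
  let L : (Fin n → ℤ) →ₗ[ℤ] Fin n → ℤ := (AddMonoidHom.mk' b hadd).toIntLinearMap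
  let B : Matrix (Fin n) (Fin n) ℤ := LinearMap.toMatrix' L
  have hB : ∀ k, B *ᵥ k = b k := fun k => LinearMap.toMatrix'_mulVec L k
  let B' : Matrix (Fin n) (Fin n) ℝ := B.map Int.cast
  have hB' : ∀ k : Fin n → ℤ, B' *ᵥ (fun i => (k i : ℝ)) = fun i => (b k i : ℝ) := by
    intro k
    ext i
    rw [← hB]
    simp [B', mulVec, dotProduct]
  let ψ : (Fin n → ℝ) → Fin n → ℝ := fun x => g x - B' *ᵥ x
  have hψ : Continuous ψ := by fun_prop
  have hψper : ∀ x y, proj x = proj y → ψ x = ψ y := by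
    intro x y hxy
    obtain ⟨k, hk⟩ := proj_eq_zero_iff.mp (show proj (x - y) = 0 by rw [proj_sub, hxy, sub_self])
    obtain rfl : x = y + fun i => (k i : ℝ) := by rw [← hk, add_sub_cancel]
    have := hb k y
    simp only [ψ, mulVec_add, hB', ← this]
    abel
  -- The section need not be continuous: periodicity of `ψ` lets it descend to the quotient.
  let s := Function.surjInv (proj_surjective (n := n))
  have hs : ∀ p, proj (s p) = p := Function.surjInv_eq _
  refine ⟨B, fun p => ψ (s p), ?_, fun p => ?_⟩
  · rw [isOpenQuotientMap_proj.isQuotientMap.continuous_iff]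
    exact hψ.congr fun x => hψper _ _ (hs _).symm
  · obtain ⟨x, rfl⟩ := proj_surjective p
    dsimp only
    rw [hψper _ x (hs _), toralEnd_proj, ← proj_add, hτg]
    congr 1
    simp [ψ, B']

/-! ### Continuous maps commuting with an ergodic automorphism are affine -/

theorem mulVec_map_intCast_eq_zero {D : Matrix (Fin n) (Fin n) ℤ}
    (h : ∀ k : Fin n → ℤ, D.map (Int.cast : ℤ → ℝ) *ᵥ (fun i => (k i : ℝ)) = 0) : D = 0 := by
  ext i j
  have := congrFun (h (Pi.single j 1)) i
  have h2 : (fun a => ((Pi.single j 1 : Fin n → ℤ) a : ℝ)) = Pi.single j 1 := by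
    ext a
    by_cases ha : a = j <;> simp [ha]
  rw [h2] at this
  simpa using this

theorem exists_affine_of_ergodic {A : GL (Fin n) ℤ} (h : Ergodic (toralAut A) (haarTorus n))
    {τ : UnitAddTorus (Fin n) → UnitAddTorus (Fin n)} (hτ : Continuous τ)
    (hcomm : ∀ p, τ (toralAut A p) = toralAut A (τ p)) :
    ∃ (B : Matrix (Fin n) (Fin n) ℤ) (c : UnitAddTorus (Fin n)), ∀ p, τ p = toralEnd B p + c := by
  obtain ⟨B, φ, hφ, hτφ⟩ := exists_matrix_add_periodic hτ
  set M := (A : Matrix (Fin n) (Fin n) ℤ)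
  have hMA : ∀ p, toralAut A p = toralEnd M p := fun _ => rfl
  -- The difference of lifts of `τ ∘ f` and `f ∘ τ`: integer-valued, hence constant.
  let δ : (Fin n → ℝ) → Fin n → ℝ := fun x =>
    (B * M - M * B).map (Int.cast : ℤ → ℝ) *ᵥ x + φ (toralAut A (proj x))
      - M.map (Int.cast : ℤ → ℝ) *ᵥ φ (proj x)
  have hδc : Continuous δ := by
    have := continuous_proj (n := n)
    fun_prop
  have hδ : ∀ x, proj (δ x) = 0 := by
    intro x
    have := hcomm (proj x)
    rw [hτφ, hτφ, hMA, hMA, toralEnd_add, ← toralEnd_mul, ← toralEnd_mul] at this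
    have hmap : (B * M - M * B).map (Int.cast : ℤ → ℝ) =
        (B * M).map (Int.cast : ℤ → ℝ) - (M * B).map (Int.cast : ℤ → ℝ) := by
      ext i j
      simp
    simp only [δ, proj_sub, proj_add, hmap, sub_mulVec, hMA, ← toralEnd_proj]
    rw [sub_eq_zero, sub_add_eq_add_sub, this, add_sub_cancel_left]
  have hconst := eq_of_proj_eq_zero hδc hδ
  have hBM : B * M - M * B = 0 := by
    refine mulVec_map_intCast_eq_zero fun k => ?_
    -- At integer points the `φ` terms agree with those at `0`, leaving only the linear part.
    have h1 := hconst (fun i => (k i : ℝ)) 0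
    have h2 : proj (0 : Fin n → ℝ) = 0 := proj_eq_zero_iff.mpr ⟨0, by ext; simp⟩
    simpa [δ, proj_intCast, h2] using h1
  let Φ : Fin n → C(UnitAddTorus (Fin n), ℂ) := fun i => ⟨fun p => (φ p i : ℂ), by fun_prop⟩
  have hΦ : ∀ i p, Φ i (toralAut A p) = ∑ j, (M i j : ℂ) * Φ j p + (δ 0 i : ℂ) := by
    intro i p
    obtain ⟨x, rfl⟩ := proj_surjective p
    rw [← hconst x 0]
    simp [δ, hBM, Φ, mulVec, dotProduct]
  obtain ⟨c, hc⟩ := exists_eq_const_of_comp_eq h hΦ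
  refine ⟨B, proj (φ 0), fun p => ?_⟩
  rw [hτφ]
  congr 2
  ext i
  have : (φ p i : ℂ) = φ 0 i := (hc i p).trans (hc i 0).symm
  exact_mod_cast this

/-! ### The Moore property -/

/-- If `w B = 0` with `w ≠ 0`, the character `w` is trivial on the image of `B`, hence on the whole
torus, contradicting its zero integral. -/
theorem det_ne_zero_of_surjective {B : Matrix (Fin n) (Fin n) ℤ} {c : UnitAddTorus (Fin n)}
    (h : Function.Surjective fun p => toralEnd B p + c) : B.det ≠ 0 := by
  intro hdet
  obtain ⟨w, hw0, hw⟩ := exists_vecMul_eq_zero_iff.mpr hdet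
  have hone : ∀ p, mFourier w p = 1 := by
    intro p
    obtain ⟨q, hq⟩ := h (p + c)
    rw [← add_right_cancel hq, mFourier_toralEnd, hw, mFourier_zero]
    rfl
  have := integral_mFourier hw0
  simp [hone] at this

theorem det_smul_eq_zero_of_toralEnd_eq_zero {B : Matrix (Fin n) (Fin n) ℤ}
    {p : UnitAddTorus (Fin n)} (h : toralEnd B p = 0) : B.det • p = 0 := by
  rw [← toralEnd_smul_one, ← adjugate_mul, toralEnd_mul, h, toralEnd_zero]

theorem finite_torsion {d : ℤ} (hd : d ≠ 0) : {p : UnitAddTorus (Fin n) | d • p = 0}.Finite := by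
  have h1 : {u : UnitAddCircle | d • u = 0}.Finite := by
    refine (AddCircle.finite_torsion (1 : ℝ) (Int.natAbs_pos.mpr hd)).subset fun u hu => ?_
    rcases Int.natAbs_eq d with hd' | hd' <;> rw [Set.mem_ofPred_eq, hd'] at hu <;>
      simpa using hu
  refine (Set.Finite.pi' fun _ : Fin n => h1).subset fun p hp i => congrFun hp i

theorem eq_zero_of_tendsto_of_torsion {A : GL (Fin n) ℤ} {d : ℤ} (hd : d ≠ 0)
    {z : UnitAddTorus (Fin n)} (hz : d • z = 0) {l : Filter ℤ} [l.NeBot]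
    (h : Tendsto (fun k : ℤ => (toralAut A ^ k) z) l (𝓝 0)) : z = 0 := by
  -- The nonzero `d`-torsion points are finite in number, so their complement is a neighbourhood of
  -- `0`.
  have hev : ∀ᶠ k in l, (toralAut A ^ k) z ∉ {p | d • p = 0} \ {0} :=
    h.eventually (((finite_torsion hd).sdiff).isClosed.isOpen_compl.mem_nhds (by simp))
  obtain ⟨k, hk⟩ := hev.exists
  have htor : d • (toralAut A ^ k) z = 0 := by
    rw [toralAut_zpow_apply, ← toralEnd_smul_one, ← toralEnd_mul, smul_one_mul,
      ← mul_smul_one, toralEnd_mul, toralEnd_smul_one, hz, toralEnd_zero]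
  have h0 : (toralAut A ^ k) z = 0 := by
    by_contra hne
    exact hk ⟨htor, hne⟩
  apply (toralAut A ^ k).injective
  rw [h0, toralAut_zpow_apply, toralEnd_zero]

end Toral

theorem mainTheorem2 (n : ℕ) (f : UnitAddTorus (Fin n) ≃ₜ UnitAddTorus (Fin n))
    (hf : Toral.IsToralAutomorphism f)
    (herg : Ergodic f (volume : Measure (UnitAddTorus (Fin n)))) :
    TopDyn.MooreProperty f := by
  obtain ⟨A, rfl⟩ := hf
  rw [Toral.volume_eq_haarTorus] at herg
  rintro τ ⟨hτ, hcomm⟩ hsurj C ⟨q, rfl⟩ x hx y hy hxy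
  obtain ⟨B, c, hBc⟩ := Toral.exists_affine_of_ergodic herg hτ hcomm
  have hdet : B.det ≠ 0 :=
    Toral.det_ne_zero_of_surjective (c := c) (by rwa [← funext hBc])
  have hhom : TopDyn.Homoclinic (Toral.toralAut A) x y :=
    (TopDyn.homoclinicSetoid (Toral.toralAut A)).trans hx
      ((TopDyn.homoclinicSetoid (Toral.toralAut A)).symm hy)
  rw [hBc, hBc] at hxy
  have hker : Toral.toralEnd B (x - y) = 0 := by
    rw [Toral.toralEnd_sub, add_right_cancel hxy, sub_self]
  have : (comap (fun k : ℤ => |k|) atTop).NeBot :=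
    comap_neBot_iff_frequently.mpr (Eventually.frequently
      ((eventually_ge_atTop 0).mono fun k hk => ⟨k, abs_of_nonneg hk⟩))
  refine sub_eq_zero.mp (Toral.eq_zero_of_tendsto_of_torsion (A := A) hdet
    (Toral.det_smul_eq_zero_of_toralEnd_eq_zero hker)
    (l := comap (fun k : ℤ => |k|) atTop) ?_)
  rw [tendsto_zero_iff_norm_tendsto_zero]
  refine Tendsto.congr (fun k => ?_) hhom
  simp only [Toral.toralAut_zpow_apply, Toral.toralEnd_sub, dist_eq_norm]
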